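/- Let $G=(V,E)$ be any (simple, possibly disconnected, possibly uncountable) graph. A ray is a 1-way infinite path in $G$; two rays are equivalent if no finite set of vertices separates them, i.e. if for every finite $X\subseteq V$ they have tails in the same component of $G-X$; the equivalence classes of rays are the ends of $G$, and $\Omega(G)$ is the set of ends. For a finite $X\subseteq V$ and an end $\omega$, let $C(X,\omega)$ be the unique component of $G-X$ that contains a tail of every ray in $\omega$, and let $\Omega(X,\omega)$ be the set of all ends $\eta$ with $C(X,\eta)=C(X,\omega)$. Let $|G|=G\cup\Omega(G)$ carry the topology MTop, which has a basis formed by all open sets of $G$ considered as a metric length space (every edge together with its endvertices is a unit interval of length $1$, and the distance of two points is the length of a shortest arc in $G$ between them, or $\infty$ if there is none) together with all the sets $$\hat C_\varepsilon(X,\omega)=C(X,\omega)\cup\Omega(X,\omega)\cup \mathring E_\varepsilon(X,C(X,\omega)),$$ where $X\subseteq V$ is finite, $\omega\in\Omega(G)$, $\varepsilon>0$, and $\mathring E_\varepsilon(X,C(X,\omega))$ is the open ball of radius $\varepsilon$ around $C(X,\omega)$ in $G$. An end is fat if there are uncountably many pairwise disjoint rays that represent it. A vertex $v$ dominates an end $\omega$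 if for some ray $R\in\omega$ there are infinitely many paths from $v$ to $R-v$, any two of which meet only in $v$. Lemma. For every graph $G$ and every end $\omega$ of $G$, the following assertions are equivalent: (i) the space $|G|$ with MTop is not first countable at $\omega$, that is, $\omega$ has no countable neighbourhood base in $|G|$; (ii) $\omega$ is fat or $\omega$ is dominated by uncountably many vertices of $G$. -/

import Mathlib

open Topology
open scoped ENNReal

namespace GraphEnds

universe u

variable {V : Type u}

/-! ### Rays and ends -/

/-- A ray (1-way infinite path) of `G`, listed from its unique first vertex. -/
structure Ray (G : SimpleGraph V) where
  vert : ℕ → V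
  injective : Function.Injective vert
  adj : ∀ n, G.Adj (vert n) (vert (n + 1))

variable {G : SimpleGraph V}

/-- The vertex set of a ray. -/
def Ray.verts (R : Ray G) : Set V := Set.range R.vert

/-- For every finite vertex set `X`, exactly one component of `G - X` contains a tail of the
ray `R`. -/
theorem Ray.existsUnique_comp (R : Ray G) (X : Finset V) :
    ∃! C : G.ComponentCompl (X : Set V), ∃ N, ∀ n, N ≤ n → R.vert n ∈ C := by
  have hfin : (R.vert ⁻¹' (X : Set V)).Finite :=
    X.finite_toSet.preimage R.injective.injOn
  obtain ⟨M, hM⟩ := hfin.bddAbove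
  have hout : ∀ n, M + 1 ≤ n → R.vert n ∉ (X : Set V) := by
    intro n hn hx
    have h : n ≤ M := hM hx
    omega
  refine ⟨G.componentComplMk (hout (M + 1) le_rfl), ⟨M + 1, ?_⟩, ?_⟩
  · intro n hn
    induction n, hn using Nat.le_induction with
    | base => exact G.componentComplMk_mem _
    | succ n hn ih =>
      exact SimpleGraph.ComponentCompl.mem_of_adj _ _ ih (hout (n + 1) (by omega)) (R.adj n)
  · rintro D ⟨N, hN⟩
    obtain ⟨h1, h2⟩ := hN (max N (M + 1)) (le_max_left _ _)
    have key : ∀ n, M + 1 ≤ n →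
        R.vert n ∈ G.componentComplMk (hout (M + 1) le_rfl) := by
      intro n hn
      induction n, hn using Nat.le_induction with
      | base => exact G.componentComplMk_mem _
      | succ n hn ih =>
        exact SimpleGraph.ComponentCompl.mem_of_adj _ _ ih (hout (n + 1) (by omega)) (R.adj n)
    obtain ⟨h3, h4⟩ := key (max N (M + 1)) (le_max_right _ _)
    exact h2.symm.trans h4

/-- The component of `G - X` that contains a tail of the ray `R`. -/
noncomputable def Ray.comp (R : Ray G) (X : Finset V) : G.ComponentCompl (X : Set V) :=
  (R.existsUnique_comp X).choose

/-- Two rays are equivalent if no finite vertex set `X` separates them, that is, if for every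
finite `X` they have tails in the same component of `G - X`. -/
instance Ray.setoid (G : SimpleGraph V) : Setoid (Ray G) where
  r R S := ∀ X : Finset V, R.comp X = S.comp X
  iseqv := ⟨fun _ _ => rfl, fun h X => (h X).symm, fun h k X => (h X).trans (k X)⟩

/-- The ends of `G`: the equivalence classes of rays. -/
def Ends (G : SimpleGraph V) : Type u := Quotient (Ray.setoid G)

/-- The end represented by a ray. -/
def Ray.toEnd (R : Ray G) : Ends G := Quotient.mk (Ray.setoid G) R

/-- `C(X, ω)`: the component of `G - X` that contains a tail of every ray in `ω`. -/
noncomputable def Ends.comp (ω : Ends G) (X : Finset V) : G.ComponentCompl (X : Set V) :=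
  Quotient.lift (s := Ray.setoid G) (fun R : Ray G => R.comp X)
    (fun R S (h : ∀ Y : Finset V, R.comp Y = S.comp Y) => h X) ω

/-- `Ω(X, ω)`: the set of ends that live in `C(X, ω)`. -/
def Ends.nearby (X : Finset V) (ω : Ends G) : Set (Ends G) :=
  {η | η.comp X = ω.comp X}

/-- An end is fat if it is represented by the members of some uncountable set of pairwise
disjoint rays. -/
def Ends.IsFat (ω : Ends G) : Prop :=
  ∃ S : Set (Ray G), ¬ S.Countable ∧ (∀ R ∈ S, R.toEnd = ω) ∧ S.PairwiseDisjoint Ray.verts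

/-- The vertex `v` dominates the ray `R`: there are infinitely many paths from `v` to vertices
of `R - v`, each meeting `R - v` only in its last vertex, any two of them meeting only
in `v`. -/
def Dominates (v : V) (R : Ray G) : Prop :=
  ∃ (w : ℕ → V) (P : ∀ n, G.Walk v (w n)),
    (∀ n, (P n).IsPath ∧ w n ∈ R.verts ∧ w n ≠ v ∧
      ∀ x ∈ (P n).support, x ∈ R.verts → x = v ∨ x = w n) ∧
    Pairwise fun m n => ∀ x ∈ (P m).support, x ∈ (P n).support → x = v

/-- The end `ω` is dominated by `v`: one of its rays is dominated by `v`. -/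
def Ends.DominatedBy (ω : Ends G) (v : V) : Prop :=
  ∃ R : Ray G, R.toEnd = ω ∧ Dominates v R

/-! ### The graph as a metric length space -/

/-- A point of the graph `G` considered as a 1-complex, given by its barycentric coordinates:
either a vertex, or a point of the segment spanned by the two endvertices of an edge. -/
@[ext]
structure Point (G : SimpleGraph V) where
  coord : V →₀ ℝ
  mem : (∃ v, coord = Finsupp.single v 1) ∨
    ∃ u v, G.Adj u v ∧ coord ∈ segment ℝ (Finsupp.single u (1 : ℝ)) (Finsupp.single v 1)

/-- The point `x` lies on the edge `uv` (endvertices included). -/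
def Point.OnEdge (x : Point G) (u v : V) : Prop :=
  G.Adj u v ∧ x.coord ∈ segment ℝ (Finsupp.single u (1 : ℝ)) (Finsupp.single v 1)

/-- `PathLength x y ℓ`: some path in `G` from `x` to `y` that is a concatenation of finitely many
segments of edges has length `ℓ`, where every edge has length `1`. -/
inductive PathLength : Point G → Point G → ℝ≥0∞ → Prop
  | nil (x : Point G) : PathLength x x 0
  | cons {x y z : Point G} {u v : V} {ℓ : ℝ≥0∞} (hx : x.OnEdge u v) (hy : y.OnEdge u v)
      (h : PathLength y z ℓ) : PathLength x z (ENNReal.ofReal |x.coord u - y.coord u| + ℓ)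

theorem PathLength.append {x y z : Point G} {a b : ℝ≥0∞} (h : PathLength x y a)
    (k : PathLength y z b) : PathLength x z (a + b) := by
  induction h with
  | nil x => simpa using k
  | cons hx hy _ ih => rw [add_assoc]; exact .cons hx hy (ih k)

theorem PathLength.symm {x y : Point G} {a : ℝ≥0∞} (h : PathLength x y a) :
    PathLength y x a := by
  induction h with
  | nil x => exact .nil x
  | cons hx hy _ ih =>
    have := ih.append (.cons hy hx (.nil _))
    rwa [add_zero, abs_sub_comm, add_comm] at this

theorem Point.OnEdge.abs_le {x y : Point G} {u v : V} (hx : x.OnEdge u v) (hy : y.OnEdge u v)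
    (w : V) : |x.coord w - y.coord w| ≤ |x.coord u - y.coord u| := by
  classical
  obtain ⟨huv, a, b, -, -, hab, hx⟩ := hx
  obtain ⟨-, c, d, -, -, hcd, hy⟩ := hy
  have hne := huv.ne
  rw [← hx, ← hy]
  by_cases h1 : u = w
  · subst h1; exact le_rfl
  by_cases h2 : v = w
  · subst h2
    simp only [Finsupp.add_apply, Finsupp.smul_apply, Finsupp.single_apply, hne, hne.symm,
      if_true, if_false, smul_eq_mul, mul_one, mul_zero, add_zero, zero_add]
    rw [show b - d = -(a - c) by linarith, abs_neg]
  · simp [Finsupp.single_apply, h1, h2]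

theorem PathLength.abs_le {x y : Point G} {a : ℝ≥0∞} (h : PathLength x y a) (w : V) :
    ENNReal.ofReal |x.coord w - y.coord w| ≤ a := by
  induction h with
  | nil x => simp
  | @cons x y z u v ℓ hx hy _ ih =>
    calc ENNReal.ofReal |x.coord w - z.coord w|
        ≤ ENNReal.ofReal (|x.coord w - y.coord w| + |y.coord w - z.coord w|) :=
          ENNReal.ofReal_le_ofReal (abs_sub_le _ _ _)
      _ ≤ ENNReal.ofReal |x.coord w - y.coord w| + ENNReal.ofReal |y.coord w - z.coord w| :=
          ENNReal.ofReal_add_le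
      _ ≤ _ := add_le_add (ENNReal.ofReal_le_ofReal (hx.abs_le hy w)) ih

/-- The distance of two points of `G` is the length of a shortest path between them
(`∞` if they lie in different components of `G`). -/
noncomputable instance : EMetricSpace (Point G) where
  edist x y := sInf {ℓ | PathLength x y ℓ}
  edist_self x := le_antisymm (sInf_le (.nil x)) zero_le
  edist_comm x y := by
    congr 1
    ext ℓ
    exact ⟨fun h => h.symm, fun h => h.symm⟩
  edist_triangle x y z := by
    rw [sInf_eq_iInf', sInf_eq_iInf', sInf_eq_iInf']
    exact ENNReal.le_iInf_add_iInf fun a b => iInf_le_of_le ⟨a.1 + b.1, a.2.append b.2⟩ le_rfl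
  eq_of_edist_eq_zero {x y} h := by
    ext w
    have h0 : ENNReal.ofReal |x.coord w - y.coord w| ≤ sInf {ℓ | PathLength x y ℓ} :=
      le_sInf fun ℓ hℓ => hℓ.abs_le w
    rw [h, nonpos_iff_eq_zero, ENNReal.ofReal_eq_zero] at h0
    exact sub_eq_zero.1 (abs_nonpos_iff.1 h0)

/-! ### The space `|G|` -/

/-- The point set `|G| = G ∪ Ω(G)`. -/
inductive Completed (G : SimpleGraph V) : Type u
  | ofPoint (x : Point G)
  | ofEnd (ω : Ends G)

/-- The component `C(X, ω)` as a subset of the metric space `G`: its vertices together with all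
points on edges between them. -/
def compPoints (X : Finset V) (ω : Ends G) : Set (Point G) :=
  {x | ∀ v ∈ x.coord.support, v ∈ ω.comp X}

/-- The basic open neighbourhood of the end `ω` given by `X` and `ε`: the component `C(X, ω)`, the
open ball of radius `ε` around it in `G`, and the set `Ω(X, ω)` of ends. -/
def basicNhd (X : Finset V) (ω : Ends G) (ε : ℝ) : Set (Completed G) :=
  Completed.ofPoint '' (compPoints X ω ∪ Metric.thickening ε (compPoints X ω)) ∪
    Completed.ofEnd '' Ends.nearby X ω

/-- The topology `MTop` on `|G|`, generated by the open sets of the metric space `G` and the basic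
open neighbourhoods of the ends. -/
instance : TopologicalSpace (Completed G) :=
  TopologicalSpace.generateFrom
    ({s | ∃ U : Set (Point G), IsOpen U ∧ s = Completed.ofPoint '' U} ∪
      {s | ∃ (X : Finset V) (ω : Ends G) (ε : ℝ), 0 < ε ∧ s = basicNhd X ω ε})

end GraphEnds

namespace GraphEnds

variable {V : Type*} {G : SimpleGraph V}

/-! Both conditions are compared with a third one: some countable `U ⊆ V` is such that every vertex
`x` has a finite `X ⊆ U` with `x ∉ C(X, ω)`.

A countable base yields `U` as the union of its finite sets `X`. Conversely, the finite subsets of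
`U` with radii `1/(n+1)` give a base: uniting separators for the vertices of a finite `X` gives a
finite `Z ⊆ U` with `C(Z, ω)` disjoint from `X`, hence inside `C(X, ω)`.

Given `U`, every ray of `ω` meets `U` and every dominating vertex lies in `U`, so `ω` is not fat and
has only countably many dominating vertices.

The hard direction is `Ends.exists_countable_separating`. Let `U` contain the vertices of a maximal
disjoint family of rays of `ω` and all dominating vertices, and be closed under chosen finite
separators of its non-dominating vertices. If no finite subset of `U` separates `x` from `ω`, then
the component `D` of `G - U` at `x` has infinitely many neighbours in `U`, all dominating `ω`. The
star-comb lemma then finds in `D` a dominating vertex or a ray of `ω`, although `U` contains all the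
former and meets all the latter. -/

/-! ### A star-comb lemma -/

/-- A parent function on the component of `x`: every parent is adjacent to its child and closer
to `x`, and `x` is the only vertex of the component that is its own parent. -/
theorem exists_parent (H : SimpleGraph V) (x : V) :
    ∃ par : V → V, (∀ y, par y ≠ y → H.Adj (par y) y ∧ H.dist x (par y) < H.dist x y) ∧
      ∀ y, H.Reachable x y → par y = y → y = x := by
  have key : ∀ y, ∃ q, (q ≠ y → H.Adj q y ∧ H.dist x q < H.dist x y) ∧
      (H.Reachable x y → q = y → y = x) := by
    intro y
    by_cases hy : H.Reachable x y ∧ y ≠ x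
    · obtain ⟨w, hw⟩ := hy.1.symm.exists_walk_length_eq_dist
      cases w with
      | nil => exact absurd rfl hy.2
      | @cons _ q _ h p =>
        refine ⟨q, fun _ => ⟨h.symm, ?_⟩, fun _ hq => absurd hq.symm h.ne⟩
        have h1 := SimpleGraph.dist_le p
        rw [SimpleGraph.Walk.length_cons] at hw
        rw [SimpleGraph.dist_comm (u := x) (v := q), SimpleGraph.dist_comm (u := x) (v := y)]
        omega
    · exact ⟨y, fun h => absurd rfl h, fun h _ => by_contra fun hne => hy ⟨h, hne⟩⟩
  choose par h1 h2 using key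
  exact ⟨par, h1, h2⟩

theorem finite_ancestors {H : SimpleGraph V} {x : V} {par : V → V}
    (hpar : ∀ y, par y ≠ y → H.Adj (par y) y ∧ H.dist x (par y) < H.dist x y) (y : V) :
    {z | ∃ k, par^[k] y = z}.Finite := by
  induction hn : H.dist x y using Nat.strong_induction_on generalizing y with
  | _ n ih =>
    by_cases hy : par y = y
    · refine (Set.finite_singleton y).subset ?_
      rintro z ⟨k, rfl⟩
      exact Function.iterate_fixed hy k
    · refine ((ih _ (hn ▸ (hpar y hy).2) (par y) rfl).insert y).subset ?_
      rintro z ⟨k, rfl⟩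
      cases k with
      | zero => exact Set.mem_insert _ _
      | succ k => exact Set.mem_insert_of_mem _ ⟨k, rfl⟩

/-- The tree path from `c` down to `y` runs through descendants of `c` only, and `X` contains none
of these. -/
theorem exists_walk_of_iterate_parent {H : SimpleGraph V} {par : V → V}
    (hpar : ∀ y, par y ≠ y → H.Adj (par y) y) {X : Set V} {c : V} (k : ℕ) {y : V}
    (hk : par^[k] y = c) (hX : ∀ z ∈ X, ∀ j, par^[j] z ≠ c) :
    ∃ p : H.Walk c y, ∀ z ∈ p.support, z ∉ X := by
  induction k generalizing y with
  | zero =>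
    obtain rfl : y = c := hk
    refine ⟨.nil, fun z hz hzX => ?_⟩
    rw [SimpleGraph.Walk.support_nil, List.mem_singleton] at hz
    exact hX z hzX 0 hz
  | succ k ih =>
    obtain ⟨p, hp⟩ := ih (y := par y) hk
    by_cases hy : par y = y
    · exact ih (y := y) (by rwa [Function.iterate_succ_apply, hy] at hk)
    · refine ⟨p.concat (hpar y hy), fun z hz hzX => ?_⟩
      rw [SimpleGraph.Walk.support_concat, List.mem_append,
        List.mem_singleton] at hz
      rcases hz with hz | rfl
      · exact hp z hz hzX
      · exact hX z hzX _ hk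

/-- Star-comb lemma: if infinitely many `u ∈ A` have their image `f u` in the component of `x`,
then this component has a vertex that finite sets do not separate from `f '' A`, or a ray whose
tails finite sets do not separate from `f '' A`. -/
theorem star_comb (H : SimpleGraph V) (x : V) {A : Set V} (hA : A.Infinite) (f : V → V)
    (hf : ∀ u ∈ A, H.Reachable x (f u)) :
    (∃ c, H.Reachable x c ∧ ∀ X : Finset V, c ∉ X →
      ∃ u ∈ A, u ∉ X ∧ ∃ p : H.Walk c (f u), ∀ z ∈ p.support, z ∉ X) ∨
    ∃ R : Ray H, (∀ n, H.Reachable x (R.vert n)) ∧ ∀ X : Finset V, ∃ N, ∀ n, N ≤ n →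
      ∃ u ∈ A, u ∉ X ∧ ∃ p : H.Walk (R.vert n) (f u), ∀ z ∈ p.support, z ∉ X := by
  obtain ⟨par, hpar, hroot⟩ := exists_parent H x
  have hadj : ∀ y, par y ≠ y → H.Adj (par y) y := fun y hy => (hpar y hy).1
  -- `B c` counts elements of `A`, not their images, because `f` need not be injective. `F X` is the
  -- set of ancestors of `X`; a vertex outside it has no descendant in `X`.
  set B : V → Set V := fun c => {u | u ∈ A ∧ ∃ k, par^[k] (f u) = c} with hB
  set F : Finset V → Set V := fun X => {z | ∃ y ∈ X, ∃ k, par^[k] y = z} with hF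
  have hFfin : ∀ X, (F X).Finite := fun X => by
    refine (X.finite_toSet.biUnion fun y _ => finite_ancestors hpar y).subset ?_
    rintro z ⟨y, hy, hz⟩
    exact Set.mem_biUnion hy hz
  have hwalk : ∀ (X : Finset V) (c y : V) (k : ℕ), par^[k] y = c → c ∉ F X →
      ∃ p : H.Walk c y, ∀ z ∈ p.support, z ∉ X := by
    intro X c y k hk hc
    exact exists_walk_of_iterate_parent (X := (X : Set V)) hadj k hk
      fun z hz j hj => hc ⟨z, hz, j, hj⟩
  have hx : (B x).Infinite := by
    refine hA.mono fun u hu => ⟨hu, ?_⟩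
    have : ∀ n y, H.dist x y = n → H.Reachable x y → ∃ k, par^[k] y = x := by
      intro n
      induction n using Nat.strong_induction_on with
      | _ n ih =>
        intro y hn hy
        by_cases h : par y = y
        · exact ⟨0, hroot y hy h⟩
        · obtain ⟨k, hk⟩ := ih _ (hn ▸ (hpar y h).2) (par y) rfl
            (hy.trans (hadj y h).symm.reachable)
          exact ⟨k + 1, hk⟩
    exact this _ _ rfl (hf u hu)
  -- Either some `c` has infinite `B c` but finite `B d` for all its children `d`, and is the centre
  -- of a star, or one can descend forever through infinite `B`. The root is its own parent, whence
  -- `d ≠ c`.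
  by_cases hstar : ∃ c, H.Reachable x c ∧ (B c).Infinite ∧
      ∀ d, par d = c → d ≠ c → (B d).Finite
  · obtain ⟨c, hc, hinf, hch⟩ := hstar
    refine Or.inl ⟨c, hc, fun X hcX => ?_⟩
    -- Only finitely many children of `c` have descendants in `X`; discarding their finite sets `B
    -- d` leaves some `u` below a harmless child, or with `f u = c`.
    have hfin : (⋃ d ∈ {d | d ∈ F X ∧ par d = c ∧ d ≠ c}, B d).Finite :=
      ((hFfin X).subset fun d hd => hd.1).biUnion fun d hd => hch d hd.2.1 hd.2.2
    obtain ⟨u, ⟨huA, huc⟩, hu⟩ := (hinf.sdiff (hfin.union X.finite_toSet)).nonempty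
    rw [Set.mem_union, not_or] at hu
    refine ⟨u, huA, hu.2, ?_⟩
    classical
    obtain ⟨k, hk, hmin⟩ : ∃ k, par^[k] (f u) = c ∧ ∀ j < k, par^[j] (f u) ≠ c :=
      ⟨Nat.find huc, Nat.find_spec huc, fun j hj => Nat.find_min huc hj⟩
    cases k with
    | zero =>
      obtain rfl : f u = c := hk
      refine ⟨.nil, fun z hz => ?_⟩
      rw [SimpleGraph.Walk.support_nil, List.mem_singleton] at hz
      rwa [hz]
    | succ j =>
      rw [Function.iterate_succ_apply'] at hk
      have hne := hmin j (Nat.lt_succ_self j)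
      obtain ⟨p, hp⟩ := hwalk X _ (f u) j rfl fun hd => hu.1 <|
        Set.mem_biUnion (show _ ∈ {d | d ∈ F X ∧ par d = c ∧ d ≠ c} from ⟨hd, hk, hne⟩)
          ⟨huA, j, rfl⟩
      have hcd := hadj (par^[j] (f u)) (by rw [hk]; exact hne.symm)
      rw [hk] at hcd
      refine ⟨.cons hcd p, fun z hz => ?_⟩
      rw [SimpleGraph.Walk.support_cons, List.mem_cons] at hz
      rcases hz with rfl | hz
      · exact hcX
      · exact hp z hz
  · push Not at hstar
    have hnext : ∀ c : {c // H.Reachable x c ∧ (B c).Infinite},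
        ∃ d : {c // H.Reachable x c ∧ (B c).Infinite}, H.Adj c.1 d.1 ∧
          H.dist x c.1 < H.dist x d.1 := by
      rintro ⟨c, hc, hinf⟩
      obtain ⟨d, rfl, hne, hd⟩ := hstar c hc hinf
      have := hpar d hne.symm
      exact ⟨⟨d, hc.trans this.1.reachable, hd⟩, this⟩
    choose next hn1 hn2 using hnext
    let s : ℕ → {c // H.Reachable x c ∧ (B c).Infinite} := fun n =>
      next^[n] ⟨x, .refl _, hx⟩
    have hs : ∀ n, s (n + 1) = next (s n) := fun n => Function.iterate_succ_apply' _ _ _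
    have hmono : StrictMono fun n => H.dist x (s n).1 := by
      refine strictMono_nat_of_lt_succ fun n => ?_
      rw [hs]; exact hn2 _
    let R : Ray H := ⟨fun n => (s n).1, fun m n h => hmono.injective (congrArg (H.dist x) h),
      fun n => by rw [hs]; exact hn1 _⟩
    refine Or.inr ⟨R, fun n => (s n).2.1, fun X => ?_⟩
    obtain ⟨M, hM⟩ := ((hFfin X).preimage (R.injective.injOn (s := R.vert ⁻¹' F X))).bddAbove
    refine ⟨M + 1, fun n hn => ?_⟩
    have hnF : R.vert n ∉ F X := fun h => by
      have : n ≤ M := hM h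
      omega
    obtain ⟨u, ⟨huA, k, hk⟩, huX⟩ := ((s n).2.2.sdiff X.finite_toSet).nonempty
    exact ⟨u, huA, huX, hwalk X _ _ k hk hnF⟩

/-! ### Components and rays -/

theorem Ray.mem_comp (R : Ray G) (X : Finset V) :
    ∃ N, ∀ n, N ≤ n → R.vert n ∈ R.toEnd.comp X :=
  (R.existsUnique_comp X).choose_spec.1

theorem Ends.exists_ray (ω : Ends G) : ∃ R : Ray G, R.toEnd = ω := Quotient.exists_rep ω

theorem Ends.notMem_of_mem_comp {ω : Ends G} {X : Finset V} {v : V} (h : v ∈ ω.comp X) :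
    v ∉ X := h.1

theorem Ends.mem_comp_of_walk {ω : Ends G} {X : Finset V} {v w : V} (p : G.Walk v w)
    (hp : ∀ z ∈ p.support, z ∉ X) (h : v ∈ ω.comp X) : ∀ z ∈ p.support, z ∈ ω.comp X := by
  induction p with
  | nil =>
    intro z hz
    rw [SimpleGraph.Walk.support_nil, List.mem_singleton] at hz
    rwa [hz]
  | @cons a b c hab p ih =>
    rw [SimpleGraph.Walk.support_cons, List.forall_mem_cons] at hp ⊢
    exact ⟨h, ih hp.2 (SimpleGraph.ComponentCompl.mem_of_adj _ _ h
      (hp.2 _ p.start_mem_support) hab)⟩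

theorem Ends.exists_walk {ω : Ends G} {X : Finset V} {v w : V} (hv : v ∈ ω.comp X)
    (hw : w ∈ ω.comp X) : ∃ p : G.Walk v w, ∀ z ∈ p.support, z ∈ ω.comp X := by
  have hv' := hv
  obtain ⟨h1, h2⟩ := hv
  obtain ⟨h3, h4⟩ := hw
  obtain ⟨p⟩ := SimpleGraph.ConnectedComponent.exact (h2.trans h4.symm)
  refine ⟨p.map (SimpleGraph.Embedding.induce ((X : Set V)ᶜ)).toHom,
    Ends.mem_comp_of_walk _ (fun z hz => ?_) hv'⟩
  replace hz := List.mem_map.1 ((SimpleGraph.Walk.support_map _ p) ▸ hz)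
  obtain ⟨y, -, rfl⟩ := hz
  exact y.2

/-- If `C(Y, ω)` misses `X`, it is connected in `G - X` and contains a tail of a ray of `ω`. -/
theorem Ends.comp_subset_comp {ω : Ends G} {X Y : Finset V}
    (h : ∀ x ∈ X, x ∉ ω.comp Y) {v : V} (hv : v ∈ ω.comp Y) : v ∈ ω.comp X := by
  obtain ⟨R, rfl⟩ := ω.exists_ray
  obtain ⟨M, hM⟩ := R.mem_comp X
  obtain ⟨N, hN⟩ := R.mem_comp Y
  obtain ⟨p, hp⟩ := Ends.exists_walk (hN (max M N) (le_max_right _ _)) hv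
  exact Ends.mem_comp_of_walk p (fun z hz hzX => h z hzX (hp z hz)) (hM _ (le_max_left _ _)) _
    p.end_mem_support

theorem Ends.comp_anti {ω : Ends G} {X Y : Finset V} (h : X ⊆ Y) {v : V}
    (hv : v ∈ ω.comp Y) : v ∈ ω.comp X :=
  Ends.comp_subset_comp (fun _ hx hy => Ends.notMem_of_mem_comp hy (h hx)) hv

theorem Ends.nearby_anti {ω η : Ends G} {X Y : Finset V} (h : X ⊆ Y)
    (hη : η ∈ Ends.nearby Y ω) : η ∈ Ends.nearby X ω := by
  obtain ⟨R, rfl⟩ := η.exists_ray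
  obtain ⟨N, hN⟩ := R.mem_comp Y
  have h1 := hN N le_rfl
  have h2 : R.vert N ∈ ω.comp Y := by
    rw [← show R.toEnd.comp Y = ω.comp Y from hη]; exact h1
  obtain ⟨_, h3⟩ := Ends.comp_anti h h1
  obtain ⟨_, h4⟩ := Ends.comp_anti h h2
  exact h3.symm.trans h4

theorem Ray.forall_mem_comp (R : Ray G) {X : Finset V} (h : ∀ n, R.vert n ∉ X) (n : ℕ) :
    R.vert n ∈ R.toEnd.comp X := by
  obtain ⟨N, hN⟩ := R.mem_comp X
  induction hk : N - n generalizing n with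
  | zero => exact hN n (by omega)
  | succ k ih =>
    exact SimpleGraph.ComponentCompl.mem_of_adj _ _ (ih (n + 1) (by omega)) (h n)
      (R.adj n).symm

theorem Ray.toEnd_eq {R : Ray G} {ω : Ends G}
    (h : ∀ X : Finset V, ∃ N, ∀ n, N ≤ n → R.vert n ∈ ω.comp X) : R.toEnd = ω := by
  obtain ⟨S, rfl⟩ := ω.exists_ray
  exact Quotient.sound (s := Ray.setoid G) fun X =>
    (R.existsUnique_comp X).unique (R.mem_comp X) (h X)

/-- The tail of a ray from its `N`th vertex on. -/
def Ray.tail (R : Ray G) (N : ℕ) : Ray G :=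
  ⟨fun n => R.vert (N + n), fun _ _ h => Nat.add_left_cancel (R.injective h),
    fun n => R.adj (N + n)⟩

theorem Ray.toEnd_tail (R : Ray G) (N : ℕ) : (R.tail N).toEnd = R.toEnd := by
  refine Ray.toEnd_eq fun X => ?_
  obtain ⟨M, hM⟩ := R.mem_comp X
  exact ⟨M, fun n hn => hM _ (by omega)⟩

/-! ### Domination -/

/-- Only finitely many paths of the fan meet `X` or end in a given initial segment of `R`; any other
one joins `v` to the tail of `R` in `C(X, ω)`. -/
theorem Ends.DominatedBy.mem_comp {ω : Ends G} {v : V} (h : ω.DominatedBy v) (X : Finset V)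
    (hv : v ∉ X) : v ∈ ω.comp X := by
  obtain ⟨R, rfl, w, P, hP, hdisj⟩ := h
  obtain ⟨N, hN⟩ := R.mem_comp X
  have hfin : ∀ Y : Finset V, v ∉ Y → {n | ∃ y ∈ Y, y ∈ (P n).support}.Finite := by
    intro Y hvY
    have : {n | ∃ y ∈ Y, y ∈ (P n).support} = ⋃ y ∈ (Y : Set V), {n | y ∈ (P n).support} := by
      ext n; simp
    rw [this]
    refine Y.finite_toSet.biUnion fun y hy => Set.Subsingleton.finite fun m hm n hn => ?_
    by_contra hmn
    exact hvY (hdisj hmn y hm hn ▸ hy)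
  classical
  obtain ⟨n, hn⟩ := ((hfin X hv).union (hfin (((Finset.range N).image R.vert).erase v)
    (Finset.notMem_erase _ _))).exists_notMem
  rw [Set.mem_union, not_or] at hn
  obtain ⟨-, ⟨k, hk⟩, hwv, -⟩ := hP n
  have hkN : N ≤ k := by
    by_contra hlt
    refine hn.2 ⟨w n, Finset.mem_erase.2 ⟨hwv, Finset.mem_image.2 ⟨k, ?_, hk⟩⟩,
      (P n).end_mem_support⟩
    simpa using hlt
  have hw : w n ∈ R.toEnd.comp X := hk ▸ hN k hkN
  refine Ends.mem_comp_of_walk (P n).reverse (fun z hz hzX => hn.1 ⟨z, hzX, ?_⟩) hw v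
    (P n).reverse.end_mem_support
  simpa using hz

/-- A shortest walk from `v` to `T` avoiding `X`, freed of repetitions, cannot meet `T` earlier. -/
theorem exists_path_of_walk {v a : V} {T X : Set V} (p : G.Walk v a) (ha : a ∈ T)
    (hp : ∀ z ∈ p.support, z ∉ X) :
    ∃ (w : V) (q : G.Walk v w), q.IsPath ∧ w ∈ T ∧
      (∀ z ∈ q.support, z ∈ T → z = w) ∧ ∀ z ∈ q.support, z ∉ X := by
  classical
  have hex : ∃ n, ∃ (w : V) (q : G.Walk v w), q.length = n ∧ w ∈ T ∧
      ∀ z ∈ q.support, z ∉ X := ⟨_, a, p, rfl, ha, hp⟩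
  obtain ⟨w, q, hq, hw, hqX⟩ := Nat.find_spec hex
  have hX : ∀ z ∈ q.bypass.support, z ∉ X := fun z hz => hqX z (q.support_bypass_subset_support hz)
  refine ⟨w, q.bypass, q.bypass_isPath, hw, fun z hz hzT => ?_, hX⟩
  by_contra hne
  refine Nat.find_min hex (m := (q.bypass.takeUntil z hz).length) ?_
    ⟨z, q.bypass.takeUntil z hz, rfl, hzT,
      fun y hy => hX y (q.bypass.support_takeUntil_subset_support hz hy)⟩
  exact (SimpleGraph.Walk.length_takeUntil_lt_length hz hne).trans_le
    (q.length_bypass_le_length.trans hq.le)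

/-- The fan is built greedily: each new path avoids the finitely many vertices other than `v` on the
previous ones. -/
theorem Ends.dominatedBy_of_mem_comp {ω : Ends G} {v : V}
    (h : ∀ X : Finset V, v ∉ X → v ∈ ω.comp X) : ω.DominatedBy v := by
  classical
  obtain ⟨R, rfl⟩ := ω.exists_ray
  have : Std.Symm fun p q : Σ w, G.Walk v w =>
      ∀ z ∈ p.2.support, z ∈ q.2.support → z = v := ⟨fun p q hpq z hz hz' => hpq z hz' hz⟩
  obtain ⟨P, hP, hdisj⟩ := exists_seq_of_forall_finset_exists' (α := Σ w, G.Walk v w)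
    (fun q => q.2.IsPath ∧ q.1 ∈ R.verts ∧ q.1 ≠ v ∧
      ∀ z ∈ q.2.support, z ∈ R.verts → z = v ∨ z = q.1)
    (fun p q => ∀ z ∈ p.2.support, z ∈ q.2.support → z = v) (by
      intro s _
      set X : Finset V := (s.biUnion fun q => q.2.support.toFinset).erase v with hX
      obtain ⟨N, hN⟩ := R.mem_comp X
      obtain ⟨k, hk, hkv⟩ : ∃ k, N ≤ k ∧ R.vert k ≠ v := by
        by_cases hNv : R.vert N = v
        · exact ⟨N + 1, by omega, fun h' => by
            have := R.injective (h'.trans hNv.symm); omega⟩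
        · exact ⟨N, le_rfl, hNv⟩
      obtain ⟨p, hp⟩ := Ends.exists_walk (h X (Finset.notMem_erase _ _)) (hN k hk)
      obtain ⟨w, q, hq, hw, hqT, hqX⟩ := exists_path_of_walk (T := R.verts \ {v})
        (X := (X : Set V)) p ⟨⟨k, rfl⟩, hkv⟩ fun z hz => Ends.notMem_of_mem_comp (hp z hz)
      refine ⟨⟨w, q⟩, ⟨hq, hw.1, hw.2, fun z hz hzR => ?_⟩, fun r hr z hz hzq => ?_⟩
      · by_cases hzv : z = v
        · exact Or.inl hzv
        · exact Or.inr (hqT z hz ⟨hzR, hzv⟩)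
      · by_contra hzv
        exact hqX z hzq (Finset.mem_erase.2 ⟨hzv, Finset.mem_biUnion.2
          ⟨r, hr, List.mem_toFinset.2 hz⟩⟩))
  exact ⟨R, rfl, fun n => (P n).1, fun n => (P n).2, hP, hdisj⟩

/-! ### Countable separation of vertices from an end -/

theorem Ends.exists_countable_meeting_rays {ω : Ends G} (hfat : ¬ ω.IsFat) :
    ∃ U : Set V, U.Countable ∧ ∀ R : Ray G, R.toEnd = ω → ∃ n, R.vert n ∈ U := by
  obtain ⟨S, hS⟩ := zorn_subset
    {S : Set (Ray G) | (∀ R ∈ S, R.toEnd = ω) ∧ S.PairwiseDisjoint Ray.verts} (by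
      intro c hc hchain
      refine ⟨⋃₀ c, ⟨?_, ?_⟩, fun s hs => Set.subset_sUnion_of_mem hs⟩
      · rintro R ⟨s, hs, hR⟩
        exact (hc hs).1 R hR
      · exact (Set.pairwiseDisjoint_sUnion hchain.directedOn).2 fun s hs => (hc hs).2)
  have hcount : S.Countable := by
    by_contra h
    exact hfat ⟨S, h, hS.prop⟩
  refine ⟨⋃ R ∈ S, R.verts, hcount.biUnion fun R _ => Set.countable_range _, fun R hR => ?_⟩
  by_contra! hn
  have hd : ∀ T ∈ S, Disjoint R.verts T.verts := by
    intro T hT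
    rw [Set.disjoint_left]
    rintro _ ⟨n, rfl⟩ hnT
    exact hn n (Set.mem_biUnion hT hnT)
  have hRS : R ∈ S := hS.le_of_ge (y := insert R S)
    ⟨Set.forall_mem_insert.2 ⟨hR, hS.prop.1⟩, hS.prop.2.insert fun T hT _ => hd T hT⟩
    (Set.subset_insert _ _) (Set.mem_insert _ _)
  exact hn 0 (Set.mem_biUnion hRS ⟨0, rfl⟩)

theorem exists_countable_closed {U : Set V} (hU : U.Countable) (X : V → Finset V) :
    ∃ W : Set V, W.Countable ∧ U ⊆ W ∧ ∀ u ∈ W, (X u : Set V) ⊆ W := by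
  let s : ℕ → Set V := fun n => Nat.rec U (fun _ T => ⋃ u ∈ T, (X u : Set V)) n
  refine ⟨⋃ n, s n, Set.countable_iUnion fun n => ?_, Set.subset_iUnion s 0, fun u hu => ?_⟩
  · induction n with
    | zero => exact hU
    | succ n ih => exact ih.biUnion fun u _ => (X u).countable_toSet
  · obtain ⟨n, hn⟩ := Set.mem_iUnion.1 hu
    exact (Set.subset_biUnion_of_mem (u := fun u => (X u : Set V)) hn).trans
      (Set.subset_iUnion s (n + 1))

theorem Ends.exists_countable_separating {ω : Ends G} (hfat : ¬ ω.IsFat)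
    (hdom : {v : V | ω.DominatedBy v}.Countable) :
    ∃ U : Set V, U.Countable ∧ ∀ x, ∃ X : Finset V, (X : Set V) ⊆ U ∧ x ∉ ω.comp X := by
  obtain ⟨U₀, hU₀, hray₀⟩ := Ends.exists_countable_meeting_rays hfat
  -- For dominating `u` the set is a dummy value, `∅`.
  have hsep : ∀ u, ∃ X : Finset V, ¬ ω.DominatedBy u → u ∉ X ∧ u ∉ ω.comp X := by
    intro u
    by_cases hu : ω.DominatedBy u
    · exact ⟨∅, fun h => absurd hu h⟩
    · by_contra! h
      exact hu (Ends.dominatedBy_of_mem_comp fun X hX => (h X).2 hX)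
  choose Y hY using hsep
  obtain ⟨U, hU, hsub, hcl⟩ := exists_countable_closed (hU₀.union hdom) Y
  have hray : ∀ R : Ray G, R.toEnd = ω → ∃ n, R.vert n ∈ U := fun R hR =>
    (hray₀ R hR).imp fun n hn => hsub (Or.inl hn)
  have hdomU : ∀ v, ω.DominatedBy v → v ∈ U := fun v hv => hsub (Or.inr hv)
  refine ⟨U, hU, fun x => ?_⟩
  by_contra! hx
  have hxU : x ∉ U := fun h =>
    Ends.notMem_of_mem_comp (hx {x} (by simpa using h)) (Finset.mem_singleton_self x)
  -- `H` keeps the vertex set and isolates `U`, so the vertices reachable from `x` in `H` form the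
  -- component `D` of `G - U`.
  let H : SimpleGraph V :=
    { Adj := fun a b => G.Adj a b ∧ a ∉ U ∧ b ∉ U
      symm := ⟨fun a b h => ⟨h.1.symm, h.2.2, h.2.1⟩⟩
      loopless := ⟨fun a h => G.loopless.irrefl a h.1⟩ }
  have hHG : H ≤ G := fun a b h => h.1
  have hDU : ∀ d, H.Reachable x d → d ∉ U := by
    rintro d ⟨p⟩
    induction p with
    | nil => exact hxU
    | cons h p ih => exact ih (fun X hX => Ends.mem_comp_of_walk (.cons h.1 .nil) (by
        intro z hz hzX
        simp only [SimpleGraph.Walk.support_cons, SimpleGraph.Walk.support_nil,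
          List.mem_cons, List.not_mem_nil, or_false] at hz
        rcases hz with rfl | rfl
        exacts [h.2.1 (hX hzX), h.2.2 (hX hzX)]) (hx X hX) _
          (SimpleGraph.Walk.end_mem_support _)) h.2.2
  have hclosed : ∀ d e, H.Reachable x d → G.Adj d e → e ∉ U → H.Reachable x e :=
    fun d e hd hde he => hd.trans
      (SimpleGraph.Adj.reachable (G := H) ⟨hde, hDU d hd, he⟩)
  have hDC : ∀ d, H.Reachable x d → ∀ X : Finset V, (X : Set V) ⊆ U → d ∈ ω.comp X := by
    rintro d ⟨p⟩ X hX
    refine Ends.mem_comp_of_walk (p.mapLe hHG) (fun z hz hzX => ?_) (hx X hX) d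
      (SimpleGraph.Walk.end_mem_support _)
    rw [SimpleGraph.Walk.support_mapLe_eq_support] at hz
    classical
    exact hDU z ⟨p.takeUntil z hz⟩ (hX hzX)
  set A : Set V := {u | u ∈ U ∧ ∃ d, H.Reachable x d ∧ G.Adj d u} with hAdef
  -- Otherwise `Y u ⊆ U` separates `u` from `ω`, while its neighbour in `D` lies in `C(Y u, ω)`.
  have hAdom : ∀ u ∈ A, ω.DominatedBy u := by
    rintro u ⟨huU, d, hd, hdu⟩
    by_contra hu
    obtain ⟨h1, h2⟩ := hY u hu
    exact h2 (SimpleGraph.ComponentCompl.mem_of_adj _ _ (hDC d hd _ (hcl u huU)) h1 hdu)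
  -- If `A` were finite, `C(A, ω)` would lie inside `D`, and a tail of a ray of `ω` would avoid `U`.
  have hAinf : A.Infinite := by
    intro hfin
    have hsubU : ((hfin.toFinset : Finset V) : Set V) ⊆ U := by
      rw [hfin.coe_toFinset]; exact fun u hu => hu.1
    have hCD : ∀ v ∈ ω.comp hfin.toFinset, H.Reachable x v := by
      intro v hv
      obtain ⟨p, hp⟩ := Ends.exists_walk (hx _ hsubU) hv
      have : ∀ {a b : V} (p : G.Walk a b), H.Reachable x a →
          (∀ z ∈ p.support, z ∈ ω.comp hfin.toFinset) → H.Reachable x b := by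
        intro a b p
        induction p with
        | nil => exact fun h _ => h
        | cons hab p ih =>
          intro ha hp
          rw [SimpleGraph.Walk.support_cons, List.forall_mem_cons] at hp
          refine ih (hclosed _ _ ha hab fun hbU => ?_) hp.2
          exact Ends.notMem_of_mem_comp (hp.2 _ p.start_mem_support)
            (hfin.mem_toFinset.2 ⟨hbU, _, ha, hab⟩)
      exact this p (.refl _) hp
    obtain ⟨R, rfl⟩ := ω.exists_ray
    obtain ⟨N, hN⟩ := R.mem_comp hfin.toFinset
    obtain ⟨n, hn⟩ := hray (R.tail N) (R.toEnd_tail N)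
    exact hDU _ (hCD _ (hN (N + n) (Nat.le_add_right _ _))) hn
  have hf : ∀ u, ∃ d, u ∈ A → H.Reachable x d ∧ G.Adj d u := by
    intro u
    by_cases hu : u ∈ A
    · obtain ⟨d, hd⟩ := hu.2
      exact ⟨d, fun _ => hd⟩
    · exact ⟨u, fun h => absurd h hu⟩
  choose f hf using hf
  -- A dominating `u ∉ X` lies in `C(X, ω)`, and membership passes along the edge to `f u` and back
  -- along the walk to `c`.
  have hback : ∀ (X : Finset V) (c u : V), u ∈ A → u ∉ X →
      (∃ p : H.Walk c (f u), ∀ z ∈ p.support, z ∉ X) → c ∈ ω.comp X := by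
    rintro X c u hu huX ⟨p, hp⟩
    have h1 : f u ∈ ω.comp X := SimpleGraph.ComponentCompl.mem_of_adj _ _
      ((hAdom u hu).mem_comp X huX) (hp _ p.end_mem_support) (hf u hu).2.symm
    refine Ends.mem_comp_of_walk (p.mapLe hHG).reverse (fun z hz => ?_) h1 c
      (SimpleGraph.Walk.end_mem_support _)
    rw [SimpleGraph.Walk.support_reverse, List.mem_reverse,
      SimpleGraph.Walk.support_mapLe_eq_support] at hz
    exact hp z hz
  rcases star_comb H x hAinf f fun u hu => (hf u hu).1 with ⟨c, hc, hstar⟩ | ⟨R, hR, hcomb⟩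
  · refine hDU c hc (hdomU c (Ends.dominatedBy_of_mem_comp fun X hcX => ?_))
    obtain ⟨u, hu, huX, hp⟩ := hstar X hcX
    exact hback X c u hu huX hp
  · obtain ⟨n, hn⟩ := hray ⟨R.vert, R.injective, fun n => hHG (R.adj n)⟩
      (Ray.toEnd_eq fun X => by
        obtain ⟨N, hN⟩ := hcomb X
        refine ⟨N, fun n hn => ?_⟩
        obtain ⟨u, hu, huX, hp⟩ := hN n hn
        exact hback X _ u hu huX hp)
    exact hDU _ (hR n) hn

/-! ### Neighbourhoods of an end -/

theorem basicNhd_mono {ω : Ends G} {X Y : Finset V} {ε δ : ℝ} (hδ : δ ≤ ε)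
    (hC : ∀ v ∈ ω.comp Y, v ∈ ω.comp X) (hN : Ends.nearby Y ω ⊆ Ends.nearby X ω) :
    basicNhd Y ω δ ⊆ basicNhd X ω ε := by
  have h : compPoints Y ω ⊆ compPoints X ω := fun x hx v hv => hC v (hx v hv)
  exact Set.union_subset_union (Set.image_mono (Set.union_subset_union h
    ((Metric.thickening_mono hδ _).trans (Metric.thickening_subset_of_subset _ h))))
    (Set.image_mono hN)

theorem basicNhd_anti {ω : Ends G} {X Y : Finset V} {ε δ : ℝ} (hδ : δ ≤ ε) (h : X ⊆ Y) :
    basicNhd Y ω δ ⊆ basicNhd X ω ε :=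
  basicNhd_mono hδ (fun _ => Ends.comp_anti h) fun _ => Ends.nearby_anti h

theorem basicNhd_congr {ω η : Ends G} {X : Finset V} (h : ω.comp X = η.comp X) (ε : ℝ) :
    basicNhd X η ε = basicNhd X ω ε := by
  simp only [basicNhd, compPoints, Ends.nearby, h]

theorem ofEnd_mem_basicNhd {ω η : Ends G} {X : Finset V} {ε : ℝ} :
    Completed.ofEnd ω ∈ basicNhd X η ε ↔ ω.comp X = η.comp X := by
  simp [basicNhd, Ends.nearby]

/-- A generating set containing `ω` is never an open set of `G`, and if it is given by `X`, `η`,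
`ε`, then `η` may be replaced by `ω`. -/
theorem nhds_ofEnd_hasBasis (ω : Ends G) :
    (𝓝 (Completed.ofEnd ω)).HasBasis (fun p : Finset V × ℝ => 0 < p.2)
      fun p => basicNhd p.1 ω p.2 := by
  classical
  have hnhds : 𝓝 (Completed.ofEnd ω) =
      ⨅ p : {p : Finset V × ℝ // 0 < p.2}, Filter.principal (basicNhd p.1.1 ω p.1.2) := by
    rw [TopologicalSpace.nhds_generateFrom]
    refine le_antisymm (le_iInf fun p => iInf₂_le _ ⟨ofEnd_mem_basicNhd.2 rfl,
      Or.inr ⟨_, _, _, p.2, rfl⟩⟩) (le_iInf₂ ?_)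
    rintro s ⟨hs, ⟨U, -, rfl⟩ | ⟨X, η, ε, hε, rfl⟩⟩
    · obtain ⟨x, -, hx⟩ := hs
      cases hx
    · rw [basicNhd_congr (ofEnd_mem_basicNhd.1 hs)]
      exact iInf_le (fun p : {p : Finset V × ℝ // 0 < p.2} =>
        Filter.principal (basicNhd p.1.1 ω p.1.2)) ⟨(X, ε), hε⟩
  have : Nonempty {p : Finset V × ℝ // 0 < p.2} := ⟨⟨(∅, 1), one_pos⟩⟩
  refine ⟨fun t => ?_⟩
  rw [hnhds, Filter.mem_iInf_of_directed]
  · simp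
  · rintro ⟨⟨X, ε⟩, hε⟩ ⟨⟨Y, δ⟩, hδ⟩
    refine ⟨⟨(X ∪ Y, min ε δ), lt_min hε hδ⟩, ?_, ?_⟩
    · exact Filter.principal_mono.2 (basicNhd_anti (min_le_left _ _) Finset.subset_union_left)
    · exact Filter.principal_mono.2 (basicNhd_anti (min_le_right _ _) Finset.subset_union_right)

theorem Ends.nhds_isCountablyGenerated {ω : Ends G} {U : Set V} (hU : U.Countable)
    (h : ∀ x, ∃ X : Finset V, (X : Set V) ⊆ U ∧ x ∉ ω.comp X) :
    (𝓝 (Completed.ofEnd ω)).IsCountablyGenerated := by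
  classical
  have := hU.to_subtype
  choose Y hYU hY using h
  refine Filter.HasBasis.isCountablyGenerated (ι := Finset U × ℕ) (p := fun _ => True)
    (s := fun p => basicNhd (p.1.map (Function.Embedding.subtype _)) ω (1 / (p.2 + 1)))
    ((nhds_ofEnd_hasBasis ω).to_hasBasis ?_ ?_)
  · rintro ⟨X, ε⟩ hε
    obtain ⟨n, hn⟩ := exists_nat_one_div_lt hε
    obtain ⟨Z, hZ⟩ : ∃ Z : Finset U, Z.map (Function.Embedding.subtype _) = X.biUnion Y := by
      refine ⟨(X.biUnion Y).subtype (· ∈ U), Finset.subtype_map_of_mem fun v hv => ?_⟩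
      obtain ⟨x, -, hv⟩ := Finset.mem_biUnion.1 hv
      exact hYU x hv
    refine ⟨(Z, n), trivial, ?_⟩
    dsimp only
    rw [hZ]
    have hC : ∀ x ∈ X, x ∉ ω.comp (X.biUnion Y) := fun x hx hxC =>
      hY x (Ends.comp_anti (Finset.subset_biUnion_of_mem Y hx) hxC)
    refine basicNhd_mono hn.le (fun v hv => Ends.comp_subset_comp hC hv) fun η hη => ?_
    have hη' : η.comp (X.biUnion Y) = ω.comp (X.biUnion Y) := hη
    obtain ⟨R, hR⟩ := η.exists_ray
    obtain ⟨N, hN⟩ := R.mem_comp (X.biUnion Y)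
    rw [hR] at hN
    have h1 := hN N le_rfl
    obtain ⟨_, h3⟩ := Ends.comp_subset_comp (ω := η) (fun x hx => hη' ▸ hC x hx) h1
    obtain ⟨_, h4⟩ := Ends.comp_subset_comp (ω := ω) hC (hη' ▸ h1)
    exact h3.symm.trans h4
  · rintro ⟨Z, n⟩ -
    exact ⟨(_, 1 / (n + 1)), by positivity, subset_rfl⟩

/-- A vertex as a point of the graph. -/
noncomputable def Point.ofVertex (G : SimpleGraph V) (v : V) : Point G :=
  ⟨Finsupp.single v 1, Or.inl ⟨v, rfl⟩⟩

theorem ofVertex_mem_basicNhd {ω : Ends G} {X : Finset V} {v : V} (ε : ℝ)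
    (h : v ∈ ω.comp X) : Completed.ofPoint (Point.ofVertex G v) ∈ basicNhd X ω ε := by
  refine Or.inl ⟨_, Or.inl fun w hw => ?_, rfl⟩
  obtain rfl : w = v := by
    by_contra hne
    exact Finsupp.mem_support_iff.1 hw (Finsupp.single_eq_of_ne hne)
  exact h

/-- The coordinate at `v` is 1-Lipschitz, equals `1` at `v` and vanishes on `C({v}, ω)`, so `v` has
distance at least `1` from that component. -/
theorem ofVertex_notMem_basicNhd {ω : Ends G} (v : V) :
    Completed.ofPoint (Point.ofVertex G v) ∉ basicNhd {v} ω 1 := by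
  have key : ∀ y ∈ compPoints {v} ω, 1 ≤ edist (Point.ofVertex G v) y := by
    intro y hy
    refine le_sInf fun ℓ hℓ => ?_
    have h0 : y.coord v = 0 := by
      by_contra hne
      exact Ends.notMem_of_mem_comp (hy v (Finsupp.mem_support_iff.2 hne))
        (Finset.mem_singleton_self v)
    have := hℓ.abs_le v
    simpa [h0, Point.ofVertex] using this
  rintro (⟨x, hx, hxv⟩ | ⟨η, -, hη⟩)
  · cases hxv
    rcases hx with hx | hx
    · have := key _ hx
      rw [edist_self] at this
      exact absurd this (by simp)
    · obtain ⟨y, hy, hlt⟩ := (Metric.mem_thickening_iff_exists_edist_lt _ _).1 hx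
      rw [ENNReal.ofReal_one] at hlt
      exact absurd (key y hy) (not_le.2 hlt)
  · cases hη

/-- If `ω` has a countable neighbourhood base, then the finite subsets of some countable set of
vertices separate every vertex from `ω`. -/
theorem Ends.exists_countable_of_isCountablyGenerated {ω : Ends G}
    (h : (𝓝 (Completed.ofEnd ω)).IsCountablyGenerated) :
    ∃ U : Set V, U.Countable ∧ ∀ v, ∃ X : Finset V, (X : Set V) ⊆ U ∧ v ∉ ω.comp X := by
  obtain ⟨p, -, hp⟩ := (nhds_ofEnd_hasBasis ω).exists_antitone_subbasis
  refine ⟨⋃ n, ((p n).1 : Set V), Set.countable_iUnion fun n => (p n).1.countable_toSet,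
    fun v => ?_⟩
  obtain ⟨n, -, hn⟩ := hp.1.mem_iff.1
    ((nhds_ofEnd_hasBasis ω).mem_of_mem (i := ({v}, 1)) one_pos)
  exact ⟨(p n).1, Set.subset_iUnion (fun n => ((p n).1 : Set V)) n, fun hv =>
    ofVertex_notMem_basicNhd v (hn (ofVertex_mem_basicNhd _ hv))⟩

/-- A ray of `ω` avoiding `U` would have its first vertex in `C(X, ω)` for every finite `X ⊆ U`.
Hence disjoint rays of `ω` pick distinct vertices of `U`. -/
theorem Ends.not_isFat_of_countable {ω : Ends G} {U : Set V} (hU : U.Countable)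
    (h : ∀ v, ∃ X : Finset V, (X : Set V) ⊆ U ∧ v ∉ ω.comp X) : ¬ ω.IsFat := by
  rintro ⟨S, hS, hω, hdisj⟩
  refine hS ?_
  have hmeet : ∀ R ∈ S, ∃ v ∈ U, v ∈ R.verts := by
    intro R hR
    by_contra! hRU
    obtain ⟨X, hX, hv⟩ := h (R.vert 0)
    rw [← hω R hR] at hv
    exact hv (R.forall_mem_comp (fun n hn => hRU _ (hX hn) ⟨n, rfl⟩) 0)
  have : Nonempty V := ω.exists_ray.nonempty.map fun R => R.vert 0
  choose! g hgU hg using hmeet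
  refine Set.MapsTo.countable_of_injOn hgU (fun R hR T hT hRT => ?_) hU
  by_contra hne
  exact Set.disjoint_left.1 (hdisj hR hT hne) (hg R hR) (hRT ▸ hg T hT)

theorem Ends.countable_dominatedBy {ω : Ends G} {U : Set V} (hU : U.Countable)
    (h : ∀ v, ∃ X : Finset V, (X : Set V) ⊆ U ∧ v ∉ ω.comp X) :
    {v | ω.DominatedBy v}.Countable := by
  refine hU.mono fun v hv => ?_
  by_contra hvU
  obtain ⟨X, hX, hvX⟩ := h v
  exact hvX (Ends.DominatedBy.mem_comp hv X fun h => hvU (hX h))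

end GraphEnds

theorem mainTheorem11 {V : Type*} (G : SimpleGraph V) (ω : GraphEnds.Ends G) :
    ¬ (𝓝 (GraphEnds.Completed.ofEnd ω)).IsCountablyGenerated ↔
      ω.IsFat ∨ ¬ {v : V | ω.DominatedBy v}.Countable := by
  rw [← not_iff_not, not_not, not_or, not_not]
  constructor
  · intro h
    obtain ⟨U, hU, hsep⟩ := GraphEnds.Ends.exists_countable_of_isCountablyGenerated h
    exact ⟨GraphEnds.Ends.not_isFat_of_countable hU hsep,
      GraphEnds.Ends.countable_dominatedBy hU hsep⟩
  · rintro ⟨hfat, hdom⟩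
    obtain ⟨U, hU, hsep⟩ := GraphEnds.Ends.exists_countable_separating hfat hdom
    exact GraphEnds.Ends.nhds_isCountablyGenerated hU hsep
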